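/- **Corollary (Unavoidable limits on total energy-per-bit).** Fix constants $\lambda,\mu,\zeta,\sigma_z^2,W,R>0$. *Implementation model $(\lambda,\mu)$.* A circuit is a square $[0,l]^2$ (of any side $l>0$) together with a finite set of nodes, all of them points of the lattice $\lambda\mathbb{Z}^2$ in that square. In a fixed-message-length computation on a circuit, distinct input bits are stored at distinct nodes, distinct output bits at distinct nodes, and a predetermined sequence of binary messages is sent, each from a predetermined node to another predetermined node and of a predetermined length that does not depend on the input. Each message is a function of the input bit stored at the transmitting node (if any) and of the messages that node has received before; in the end each output bit is a function of the input bit stored at its node (if any) and of all messages received there. The bit-meters of the computation are the sum, over all ordered pairs of distinct nodes, of the total number of bits sent from the first node to the second times the Euclidean distance between them; the energy of the computation is $\mu$ times its bit-meters. *Communication system.* For $k,n\ge 1$ with $k/n=R$, an encoder (a fixed-message-length computation with $k$ input bits and $n$ output bits, on some circuit) maps $k$ fair coin flips $\mathbf b$ to a codeword in $\{0,1\}^n$. The codeword is sent with BPSK at transmit power $P_T\ge 0$ through an AWGN channel with path loss $\zeta$, noise variance $\sigma_z^2$ and $W$ channel uses per second, followed by hard decisions; that is, through $n$ uses of the binary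 symmetric channel with crossover probability $p_{ch}=\mathbb{Q}\big(\sqrt{\zeta P_T/\sigma_z^2}\big)$, where $\mathbb{Q}(x)=\int_x^\infty \frac{1}{\sqrt{2\pi}}e^{-t^2/2}\,dt$. A decoder (a fixed-message-length computation with $n$ input bits and $k$ output bits, on some circuit) maps the $n$ hard decisions to an estimate $\widehat{\mathbf b}$. Let $P_e^{blk}=\Pr(\widehat{\mathbf b}\ne\mathbf b)$, and let $$E_{total}=\frac{nP_T}{W}+\mu\cdot\text{bit-meters}(\text{encoder})+\mu\cdot\text{bit-meters}(\text{decoder}).$$ *Claim.* There are $c,\varepsilon>0$, depending only on $\lambda,\mu,\zeta,\sigma_z^2,W,R$, such that every such communication system (with any $k$, $n$, $P_T$, circuits, encoder and decoder) with $P_e^{blk}\le\varepsilon$ satisfies $$\frac{E_{total}}{k}\ \ge\ c\,\sqrt[3]{\log\frac{1}{P_e^{blk}}}.$$ Consequently the total energy per bit diverges as $P_e^{blk}\to 0$: for every $M$ there is $\varepsilon>0$ such that every such system with $P_e^{blk}\le\varepsilon$ has $E_{total}/k\ge M$. -/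

import Mathlib

/-! ### Substrate, grid and circuits -/

/-- The plane, with its Euclidean distance. -/
abbrev Plane : Type := EuclideanSpace ℝ (Fin 2)

/-- The substrate `Sq(l)`: the square with vertices `(0,0)`, `(0,l)`, `(l,0)`, `(l,l)`. -/
def Substrate (l : ℝ) : Set Plane :=
  {p | ∀ i, 0 ≤ p i ∧ p i ≤ l}

/-- The points `(s * lam, t * lam)` with `s`, `t` integers. -/
def SquareLattice (lam : ℝ) : Set Plane :=
  {p | ∃ s t : ℤ, p 0 = s * lam ∧ p 1 = t * lam}

/-- The lattice points that lie in the substrate. -/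
def Grid (lam l : ℝ) : Set Plane :=
  SquareLattice lam ∩ Substrate l

/-- A circuit: a substrate together with a (necessarily finite) set of grid points, the
computational nodes. -/
structure Circuit (lam : ℝ) where
  side : ℝ
  side_pos : 0 < side
  nodes : Finset Plane
  nodes_subset : (nodes : Set Plane) ⊆ Grid lam side

/-- The computational nodes of a circuit, as a (finite) type. -/
abbrev Circuit.Node {lam : ℝ} (C : Circuit lam) : Type := {p : Plane // p ∈ C.nodes}

/-! ### Fixed-message-length computation -/

/-- A fixed-message-length computation on the circuit `C`, with `m` input bits and `m'` output bits.
Distinct input bits are stored at distinct nodes, and so are distinct output bits.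
A predetermined sequence of messages is sent: the `t`-th one goes from the node `src t` to another
node `dst t` and has the predetermined length `bits t`. Its content is computed by the
function `rule t` from what the transmitting node knows at that time: its input bit, if it is an
input node, and the messages which it has received before. In the end each output bit is computed
in the same manner from what its output node knows. -/
structure FixedLengthComputation {lam : ℝ} (C : Circuit lam) (m m' : ℕ) where
  inputNode : Fin m ↪ C.Node
  outputNode : Fin m' ↪ C.Node
  numMessages : ℕ
  src : Fin numMessages → C.Node
  dst : Fin numMessages → C.Node
  src_ne_dst : ∀ t, src t ≠ dst t
  bits : Fin numMessages → ℕ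
  rule : (t : Fin numMessages) →
    ({i : Fin m // inputNode i = src t} → Bool) →
    ((s : {s : Fin numMessages // s < t ∧ dst s = src t}) → Fin (bits s.1) → Bool) →
    Fin (bits t) → Bool
  outputRule : (j : Fin m') →
    ({i : Fin m // inputNode i = outputNode j} → Bool) →
    ((s : {s : Fin numMessages // dst s = outputNode j}) → Fin (bits s.1) → Bool) →
    Bool

namespace FixedLengthComputation

variable {lam : ℝ} {C : Circuit lam} {m m' : ℕ}

/-- The content of the `t`-th message when the computation is run on the input `x`. -/
def message (A : FixedLengthComputation C m m') (x : Fin m → Bool) (t : Fin A.numMessages) :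
    Fin (A.bits t) → Bool :=
  A.rule t (fun i => x i.1) (fun s => A.message x s.1)
termination_by t.1
decreasing_by exact s.2.1

/-- The output of the computation on the input `x`. -/
def output (A : FixedLengthComputation C m m') (x : Fin m → Bool) : Fin m' → Bool :=
  fun j => A.outputRule j (fun i => x i.1) (fun s => A.message x s.1)

open Classical in
/-- The total number of bits carried by the messages on the link from `u` to `v`. -/
noncomputable def linkBits (A : FixedLengthComputation C m m') (u v : C.Node) : ℕ :=
  ∑ t : Fin A.numMessages, if A.src t = u ∧ A.dst t = v then A.bits t else 0

/-- The bit-meters of the link from `u` to `v`. -/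
noncomputable def linkBitMeters (A : FixedLengthComputation C m m') (u v : C.Node) : ℝ :=
  (A.linkBits u v : ℝ) * dist (u : Plane) (v : Plane)

/-- The bit-meters of the computation: the sum over all (unidirectional) links. -/
noncomputable def bitMeters (A : FixedLengthComputation C m m') : ℝ :=
  ∑ u : C.Node, ∑ v : C.Node, A.linkBitMeters u v

/-- The information-friction energy, with coefficient of information-friction `mu`. -/
noncomputable def frictionEnergy (A : FixedLengthComputation C m m') (mu : ℝ) : ℝ :=
  mu * A.bitMeters

end FixedLengthComputation

/-! ### The channel -/

/-- The Gaussian tail function. -/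
noncomputable def gaussianQ (x : ℝ) : ℝ :=
  ∫ t in Set.Ioi x, 1 / Real.sqrt (2 * Real.pi) * Real.exp (-t ^ 2 / 2)

/-- The raw bit-error probability after a hard decision on BPSK symbols of power `P`, for path loss
`zeta` and noise variance `sigmaSq`. -/
noncomputable def crossover (zeta sigmaSq P : ℝ) : ℝ :=
  gaussianQ (Real.sqrt (zeta * P / sigmaSq))

/-- Transition probability of `n` uses of the binary symmetric channel with crossover
probability `p`. -/
noncomputable def bscProb {n : ℕ} (p : ℝ) (x y : Fin n → Bool) : ℝ :=
  ∏ i, if y i = x i then 1 - p else p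

/-! ### The communication system -/

/-- A communication system of rate `R` whose encoder and decoder are fixed-message-length
computations on circuits with node spacing `lam`: `k` information bits, block length `n`,
transmit power `power`. -/
structure CommSystem (lam R : ℝ) where
  k : ℕ
  n : ℕ
  k_pos : 0 < k
  n_pos : 0 < n
  rate_eq : (k : ℝ) / (n : ℝ) = R
  power : ℝ
  power_nonneg : 0 ≤ power
  encCircuit : Circuit lam
  encoder : FixedLengthComputation encCircuit k n
  decCircuit : Circuit lam
  decoder : FixedLengthComputation decCircuit n k

namespace CommSystem

variable {lam R : ℝ}

/-- The average block-error probability: `k` fair coin flips `b` are encoded, sent through the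
channel, and decoded from the channel output `y`. -/
noncomputable def blockErrorProb (S : CommSystem lam R) (zeta sigmaSq : ℝ) : ℝ :=
  ∑ b : Fin S.k → Bool, (1 / 2 : ℝ) ^ S.k *
    ∑ y : Fin S.n → Bool,
      bscProb (crossover zeta sigmaSq S.power) (S.encoder.output b) y *
        (if S.decoder.output y = b then 0 else 1)

/-- The transmit energy of a block: `n` channel uses, at `W` channel uses per second. -/
noncomputable def transmitEnergy (S : CommSystem lam R) (W : ℝ) : ℝ :=
  S.n * S.power / W

/-- Total energy of a block: transmission, encoding, and decoding. -/
noncomputable def totalEnergy (S : CommSystem lam R) (mu W : ℝ) : ℝ :=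
  S.transmitEnergy W + S.encoder.frictionEnergy mu + S.decoder.frictionEnergy mu

/-- Total energy per information bit. -/
noncomputable def energyPerBit (S : CommSystem lam R) (mu W : ℝ) : ℝ :=
  S.totalEnergy mu W / S.k

end CommSystem

/-! Only the decoder's bit-meters and the transmit power matter. Cut the decoder's grid into cells
of `s × s` lattice points. A message of short reach is cut by few translates of this division, so
averaging over the `s` diagonal shifts gives one where at most `2 / (lam * s)` times the bit-meters
cross between cells (`exists_shift`). If this is less than `k`, some cell receives fewer bits than
it outputs (`exists_cell_inflow_lt`).

Such a cell depends on the channel outputs stored in it, at most `s ^ 2` of them. If noise turns all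
of these into `false`, the cell's outputs are a function of its inflow alone and miss at least half
of the messages. As the crossover probability `p` is at most `1 / 2`, noise can do this to any
codeword at a cost of at most `p` per bit, whence `le_error_of_inflow_lt`.

With `p ≥ exp (-(SNR + 2))`, the logarithm of the inverse error probability is at most of order `(1
+ SNR) * s ^ 2`. At energy per bit `E`, both the SNR and the smallest admissible `s` are `O(1 + E)`,
which gives a cubic bound; its inverse is the cube root. -/

/-! ### Runs that agree on a region -/

namespace FixedLengthComputation

variable {lam : ℝ} {C : Circuit lam} {m m' : ℕ}

/-- If two inputs agree on a region `T`, and so do the messages that enter `T`, then all messages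
that are sent or received in `T` agree. -/
theorem message_eq_of_agree (A : FixedLengthComputation C m m') (T : Set C.Node)
    {x x' : Fin m → Bool} (hx : ∀ i, A.inputNode i ∈ T → x i = x' i)
    (hin : ∀ t, A.src t ∉ T → A.dst t ∈ T → A.message x t = A.message x' t)
    (t : Fin A.numMessages) (ht : A.src t ∈ T ∨ A.dst t ∈ T) :
    A.message x t = A.message x' t := by
  induction t using WellFoundedLT.induction with
  | ind t ih =>
    -- A message sent from `T` depends only on inputs in `T` and on earlier messages received in
    -- `T`; one sent from outside enters `T`.
    by_cases hs : A.src t ∈ T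
    · rw [message, message]
      congr 1
      · funext i
        exact hx i.1 (by rw [i.2]; exact hs)
      · funext s
        exact ih s.1 s.2.1 (Or.inr (by rw [s.2.2]; exact hs))
    · exact hin t hs (ht.resolve_left hs)

theorem output_eq_of_agree (A : FixedLengthComputation C m m') (T : Set C.Node)
    {x x' : Fin m → Bool} (hx : ∀ i, A.inputNode i ∈ T → x i = x' i)
    (hin : ∀ t, A.src t ∉ T → A.dst t ∈ T → A.message x t = A.message x' t)
    (j : Fin m') (hj : A.outputNode j ∈ T) : A.output x j = A.output x' j := by
  unfold output
  congr 1
  · funext i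
    exact hx i.1 (by rw [i.2]; exact hj)
  · funext s
    exact A.message_eq_of_agree T hx hin s.1 (Or.inr (by rw [s.2]; exact hj))

end FixedLengthComputation

open Classical in
/-- The number of bits that enter the region `T`. -/
noncomputable def FixedLengthComputation.inflow {lam : ℝ} {C : Circuit lam} {m m' : ℕ}
    (A : FixedLengthComputation C m m') (T : Set C.Node) : ℕ :=
  ∑ t, if A.src t ∉ T ∧ A.dst t ∈ T then A.bits t else 0

open Classical in
/-- The number of inputs that are stored in the region `T`. -/
noncomputable def FixedLengthComputation.numInputs {lam : ℝ} {C : Circuit lam} {m m' : ℕ}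
    (A : FixedLengthComputation C m m') (T : Set C.Node) : ℕ :=
  Fintype.card {i // A.inputNode i ∈ T}

open Classical in
/-- The number of outputs that are stored in the region `T`. -/
noncomputable def FixedLengthComputation.numOutputs {lam : ℝ} {C : Circuit lam} {m m' : ℕ}
    (A : FixedLengthComputation C m m') (T : Set C.Node) : ℕ :=
  Fintype.card {j // A.outputNode j ∈ T}

/-! ### Counting the outputs of a region whose inputs are erased -/

namespace FixedLengthComputation

variable {lam : ℝ} {C : Circuit lam} {m m' : ℕ}

open Classical in
/-- The input `x`, with the bits stored in the region `T` replaced by `false`. -/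
noncomputable def clear (A : FixedLengthComputation C m m') (T : Set C.Node) (x : Fin m → Bool) :
    Fin m → Bool :=
  fun i => if A.inputNode i ∈ T then false else x i

open Classical in
theorem card_fiber_clear_le (A : FixedLengthComputation C m m') (T : Set C.Node)
    (y : Fin m → Bool) :
    (Finset.univ.filter fun z => A.clear T z = y).card ≤ 2 ^ A.numInputs T := by
  have h := Finset.card_le_card_of_injOn (s := Finset.univ.filter fun z => A.clear T z = y)
    (t := (Finset.univ : Finset ({i // A.inputNode i ∈ T} → Bool)))
    (fun z i => z i.1) (fun _ _ => Finset.mem_coe.2 (Finset.mem_univ _)) (by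
      intro z hz w hw hzw
      simp only [Finset.coe_filter, Finset.mem_univ, true_and, Set.mem_ofPred_eq] at hz hw
      funext i
      by_cases hi : A.inputNode i ∈ T
      · exact congrFun hzw ⟨i, hi⟩
      · have := congrFun (hz.trans hw.symm) i
        simpa [clear, hi] using this)
  simpa [numInputs] using h

open Classical in
/-- With the inputs in `T` cleared, few outputs are possible on `T`. -/
theorem card_outputs_le (A : FixedLengthComputation C m m') (T : Set C.Node) :
    (Finset.univ.filter fun b : Fin m' → Bool => ∃ z, ∀ j, A.outputNode j ∈ T →
      A.output (A.clear T z) j = b j).card * 2 ^ A.numOutputs T ≤ 2 ^ A.inflow T * 2 ^ m' := by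
  set S := Finset.univ.filter fun b : Fin m' → Bool => ∃ z, ∀ j, A.outputNode j ∈ T →
      A.output (A.clear T z) j = b j with hS
  have hmem : ∀ b ∈ S, ∃ z, ∀ j, A.outputNode j ∈ T → A.output (A.clear T z) j = b j := by
    intro b hb
    simpa [hS] using hb
  choose! z hz using hmem
  -- Each `b` in `S` is encoded by the messages entering `T` in a run that witnesses it, and by its
  -- own bits outside `T`. This is injective: cleared inputs all agree on `T`, so the entering
  -- messages fix the outputs there.
  let D := ((t : {t // A.src t ∉ T ∧ A.dst t ∈ T}) → Fin (A.bits t.1) → Bool) ×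
    ({j // ¬ A.outputNode j ∈ T} → Bool)
  have hcard : S.card ≤ Fintype.card D := by
    refine Finset.card_le_card_of_injOn (t := (Finset.univ : Finset D))
      (fun b => (fun t => A.message (A.clear T (z b)) t.1, fun j => b j.1))
      (fun _ _ => Finset.mem_coe.2 (Finset.mem_univ _)) ?_
    intro b hb b' hb' h
    funext j
    by_cases hj : A.outputNode j ∈ T
    · rw [← hz b hb j hj, ← hz b' hb' j hj]
      refine A.output_eq_of_agree T (fun i hi => by simp [clear, hi]) (fun t h1 h2 => ?_) j hj
      exact congrFun (congrArg Prod.fst h) ⟨t, h1, h2⟩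
    · exact congrFun (congrArg Prod.snd h) ⟨j, hj⟩
  have hD : Fintype.card D = 2 ^ A.inflow T * 2 ^ (m' - A.numOutputs T) := by
    have h1 : ∑ t : {t // A.src t ∉ T ∧ A.dst t ∈ T}, A.bits t.1 = A.inflow T := by
      rw [inflow, ← Finset.sum_filter]
      exact (Finset.sum_subtype _ (fun t => by simp) _).symm
    have h2 : Fintype.card {j // ¬ A.outputNode j ∈ T} = m' - A.numOutputs T := by
      rw [Fintype.card_subtype_compl, Fintype.card_fin, numOutputs]
    simp only [D, Fintype.card_prod, Fintype.card_pi, Fintype.card_bool, Finset.prod_const,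
      Finset.card_univ, Fintype.card_fin, h2, Finset.prod_pow_eq_pow_sum, h1]
  have hle : A.numOutputs T ≤ m' := by
    simpa [numOutputs] using Fintype.card_subtype_le fun j => A.outputNode j ∈ T
  calc S.card * 2 ^ A.numOutputs T
      ≤ 2 ^ A.inflow T * 2 ^ (m' - A.numOutputs T) * 2 ^ A.numOutputs T :=
        Nat.mul_le_mul_right _ (hcard.trans hD.le)
    _ = 2 ^ A.inflow T * 2 ^ m' := by
        rw [mul_assoc, ← pow_add, Nat.sub_add_cancel hle]

end FixedLengthComputation

/-! ### Transition probabilities of the binary symmetric channel -/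

theorem bscProb_nonneg {n : ℕ} {p : ℝ} (h0 : 0 ≤ p) (h1 : p ≤ 1) (x y : Fin n → Bool) :
    0 ≤ bscProb p x y :=
  Finset.prod_nonneg fun i _ => by split_ifs <;> linarith

theorem sum_bscProb {n : ℕ} (p : ℝ) (x : Fin n → Bool) : ∑ y, bscProb p x y = 1 := by
  have h := Finset.prod_univ_sum (fun _ : Fin n => (Finset.univ : Finset Bool))
    (fun i b => if b = x i then 1 - p else p)
  rw [Fintype.piFinset_univ] at h
  unfold bscProb
  rw [← h]
  refine Finset.prod_eq_one fun i _ => ?_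
  cases x i <;> simp

namespace FixedLengthComputation

variable {lam : ℝ} {C : Circuit lam} {m m' : ℕ}

/-- Factor by factor: in `T` the cleared bit has probability at least `p`, since `p ≤ 1 - p`;
elsewhere nothing changes. -/
theorem pow_mul_bscProb_le (A : FixedLengthComputation C m m') (T : Set C.Node) {p : ℝ}
    (h0 : 0 ≤ p) (h1 : p ≤ 1 / 2) (x z : Fin m → Bool) :
    p ^ A.numInputs T * bscProb p x z ≤ bscProb p x (A.clear T z) := by
  classical
  have hpow : p ^ A.numInputs T = ∏ i, if A.inputNode i ∈ T then p else 1 := by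
    rw [Finset.prod_ite, Finset.prod_const, Finset.prod_const_one, mul_one, numInputs,
      Fintype.card_subtype]
  rw [hpow, bscProb, bscProb, ← Finset.prod_mul_distrib]
  refine Finset.prod_le_prod (fun i _ => ?_) (fun i _ => ?_)
  · apply mul_nonneg <;> split_ifs <;> linarith
  · by_cases hi : A.inputNode i ∈ T
    · simp only [clear, hi, if_true]
      split_ifs <;> nlinarith
    · simp [clear, hi]

open Classical in
/-- A decoder in which fewer bits enter some region than are output there errs at least when the
channel noise hides the inputs in that region. -/
theorem le_error_of_inflow_lt {n k : ℕ} (A : FixedLengthComputation C n k) (T : Set C.Node)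
    (hT : A.inflow T < A.numOutputs T) {p : ℝ} (h0 : 0 < p) (h1 : p ≤ 1 / 2)
    (enc : (Fin k → Bool) → (Fin n → Bool)) :
    (p / 2) ^ A.numInputs T / 2 ≤ ∑ b : Fin k → Bool, (1 / 2 : ℝ) ^ k *
      ∑ y : Fin n → Bool, bscProb p (enc b) y * (if A.output y = b then 0 else 1) := by
  set N := A.numInputs T
  have hnn : ∀ x y : Fin n → Bool, 0 ≤ bscProb p x y :=
    bscProb_nonneg h0.le (by linarith)
  set S := Finset.univ.filter fun b : Fin k → Bool => ∃ z, ∀ j, A.outputNode j ∈ T →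
      A.output (A.clear T z) j = b j with hS
  -- The strict inequality `hT` is worth one whole bit, hence a factor of two.
  have hScard : (S.card : ℝ) * (1 / 2) ^ k ≤ 1 / 2 := by
    have h := A.card_outputs_le T
    rw [← hS] at h
    have h2 : S.card * 2 ^ (A.inflow T + 1) ≤ 2 ^ A.inflow T * 2 ^ k :=
      (Nat.mul_le_mul_left _ (Nat.pow_le_pow_right two_pos hT)).trans h
    have h3 : S.card * 2 ≤ 2 ^ k := by
      refine Nat.le_of_mul_le_mul_left (c := 2 ^ A.inflow T) ?_ (by positivity)
      calc _ = S.card * 2 ^ (A.inflow T + 1) := by ring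
        _ ≤ _ := h2
    have h4 : (S.card : ℝ) * 2 ≤ 2 ^ k := by exact_mod_cast h3
    rw [one_div_pow, mul_one_div, div_le_iff₀ (by positivity)]
    linarith
  -- off `S`, a decoder that sees a cleared channel output errs for sure
  have hb : ∀ b ∉ S, (p / 2) ^ N ≤
      ∑ y : Fin n → Bool, bscProb p (enc b) y * (if A.output y = b then 0 else 1) := by
    intro b hbS
    have herr : ∀ z, A.output (A.clear T z) ≠ b := by
      intro z hz
      apply hbS
      simp only [hS, Finset.mem_filter, Finset.mem_univ, true_and]
      exact ⟨z, fun j _ => congrFun hz j⟩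
    set g : (Fin n → Bool) → ℝ :=
      fun y => bscProb p (enc b) y * (if A.output y = b then 0 else 1) with hg
    have hgnn : ∀ y, 0 ≤ g y := fun y =>
      mul_nonneg (hnn _ _) (by split_ifs <;> norm_num)
    have h2 : p ^ N ≤ ∑ z, g (A.clear T z) := by
      calc p ^ N = ∑ z, p ^ N * bscProb p (enc b) z := by
            rw [← Finset.mul_sum, sum_bscProb, mul_one]
        _ ≤ ∑ z, g (A.clear T z) := Finset.sum_le_sum fun z _ => by
            simp only [hg, herr z, if_false, mul_one]
            exact A.pow_mul_bscProb_le T h0.le h1 _ z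
    -- Clearing identifies at most `2 ^ N` words; this overcount turns `p` into `p / 2`.
    have h3 : ∑ z, g (A.clear T z) ≤ 2 ^ N * ∑ y, g y := by
      rw [← Finset.sum_fiberwise_of_maps_to (g := A.clear T) (t := Finset.univ)
        (fun _ _ => Finset.mem_univ _), Finset.mul_sum]
      refine Finset.sum_le_sum fun y _ => ?_
      rw [Finset.sum_congr rfl (g := fun _ => g y)
        (fun z hz => by rw [(Finset.mem_filter.1 hz).2]), Finset.sum_const, nsmul_eq_mul]
      refine mul_le_mul_of_nonneg_right ?_ (hgnn y)
      exact_mod_cast A.card_fiber_clear_le T y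
    rw [div_pow, div_le_iff₀ (by positivity)]
    linarith
  have hSc : (1 : ℝ) / 2 ≤ (Sᶜ.card : ℝ) * (1 / 2) ^ k := by
    have h : (S.card : ℝ) + Sᶜ.card = 2 ^ k := by
      have := Finset.card_add_card_compl S
      rw [Fintype.card_pi, Finset.prod_const, Fintype.card_bool, Finset.card_univ,
        Fintype.card_fin] at this
      exact_mod_cast this
    have h' : ((S.card : ℝ) + Sᶜ.card) * (1 / 2) ^ k = 1 := by
      rw [h, ← mul_pow]; norm_num
    linarith
  calc (p / 2) ^ N / 2 ≤ (Sᶜ.card : ℝ) * (1 / 2) ^ k * (p / 2) ^ N := by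
        have : 0 ≤ (p / 2) ^ N := by positivity
        nlinarith
    _ = ∑ b ∈ Sᶜ, (1 / 2 : ℝ) ^ k * (p / 2) ^ N := by
        rw [Finset.sum_const, nsmul_eq_mul, mul_assoc]
    _ ≤ ∑ b ∈ Sᶜ, (1 / 2 : ℝ) ^ k *
          ∑ y : Fin n → Bool, bscProb p (enc b) y * (if A.output y = b then 0 else 1) :=
        Finset.sum_le_sum fun b h =>
          mul_le_mul_of_nonneg_left (hb b (Finset.mem_compl.1 h)) (by positivity)
    _ ≤ _ := Finset.sum_le_sum_of_subset_of_nonneg (Finset.subset_univ _) fun b _ _ =>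
        mul_nonneg (by positivity) (Finset.sum_nonneg fun y _ =>
          mul_nonneg (hnn _ _) (by split_ifs <;> norm_num))

end FixedLengthComputation

/-! ### The Gaussian tail -/

theorem integrable_gaussianDensity :
    MeasureTheory.Integrable
      (fun t : ℝ => 1 / Real.sqrt (2 * Real.pi) * Real.exp (-t ^ 2 / 2)) := by
  have h := (integrable_exp_neg_mul_sq (b := 1 / 2) (by norm_num)).const_mul
    (1 / Real.sqrt (2 * Real.pi))
  refine h.congr (Filter.Eventually.of_forall fun t => ?_)
  simp only
  congr 2
  ring

theorem gaussianQ_le_half {x : ℝ} (hx : 0 ≤ x) : gaussianQ x ≤ 1 / 2 := by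
  have h0 : gaussianQ 0 = 1 / 2 := by
    unfold gaussianQ
    rw [MeasureTheory.integral_const_mul]
    have h := integral_gaussian_Ioi (1 / 2)
    have h' : ∀ t : ℝ, Real.exp (-t ^ 2 / 2) = Real.exp (-(1 / 2) * t ^ 2) := fun t => by
      congr 1; ring
    simp only [h', h]
    rw [show Real.pi / (1 / 2) = 2 * Real.pi by ring]
    have : Real.sqrt (2 * Real.pi) ≠ 0 := by positivity
    field_simp
  rw [← h0]
  exact MeasureTheory.setIntegral_mono_set integrable_gaussianDensity.integrableOn
    (Filter.Eventually.of_forall fun t => by simp only [Pi.zero_apply]; positivity)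
    (Set.Ioi_subset_Ioi hx).eventuallyLE

/-- The interval `(x, x + 1]` has enough mass: there the exponent is at least `-(x + 1) ^ 2 / 2 ≥
-(x ^ 2 + 1)`, and the normalising factor is at least `exp (-1)`. -/
theorem exp_le_gaussianQ {x : ℝ} (hx : 0 ≤ x) : Real.exp (-(x ^ 2 + 2)) ≤ gaussianQ x := by
  have hsqrt : Real.sqrt (2 * Real.pi) ≤ Real.exp 1 := by
    rw [Real.sqrt_le_left (Real.exp_pos _).le]
    nlinarith [Real.pi_lt_d2, Real.exp_one_gt_d9]
  have hc : Real.exp (-1) ≤ 1 / Real.sqrt (2 * Real.pi) := by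
    rw [Real.exp_neg, ← one_div]
    exact one_div_le_one_div_of_le (by positivity) hsqrt
  have h1 : ∫ t in Set.Ioc x (x + 1), Real.exp (-(x ^ 2 + 2)) ≤
      ∫ t in Set.Ioc x (x + 1), 1 / Real.sqrt (2 * Real.pi) * Real.exp (-t ^ 2 / 2) := by
    refine MeasureTheory.setIntegral_mono_on (by simp)
      integrable_gaussianDensity.integrableOn measurableSet_Ioc fun t ht => ?_
    calc Real.exp (-(x ^ 2 + 2)) = Real.exp (-1) * Real.exp (-(x ^ 2 + 1)) := by
          rw [← Real.exp_add]; congr 1; ring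
      _ ≤ _ := by
          refine mul_le_mul hc (Real.exp_le_exp.2 ?_) (Real.exp_pos _).le (by positivity)
          have h2 : t ^ 2 ≤ (x + 1) ^ 2 := by
            have := ht.1
            have := ht.2
            gcongr
            linarith
          nlinarith [sq_nonneg (x - 1)]
  have h2 : ∫ t in Set.Ioc x (x + 1), 1 / Real.sqrt (2 * Real.pi) * Real.exp (-t ^ 2 / 2) ≤
      gaussianQ x :=
    MeasureTheory.setIntegral_mono_set integrable_gaussianDensity.integrableOn
      (Filter.Eventually.of_forall fun t => by simp only [Pi.zero_apply]; positivity)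
      Set.Ioc_subset_Ioi_self.eventuallyLE
  refine le_trans ?_ (h1.trans h2)
  simp

/-! ### Cells of the grid -/

/-- A shift of the division into cells of length `m` separates few neighbours on average. -/
theorem card_shift_ediv_ne_le (m : ℕ) (x y : ℤ) :
    (((Finset.range m).filter fun a : ℕ => (x + a) / (m : ℤ) ≠ (y + a) / (m : ℤ)).card : ℤ) ≤
      |x - y| := by
  wlog hxy : x ≤ y generalizing x y
  · have := this y x (by omega)
    rw [abs_sub_comm]
    simpa only [ne_comm] using this
  -- Raising `d` by one slides a window of `m` consecutive quotients: the first leaves and reappears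
  -- at the end increased by one.
  have hsum : ∀ d : ℕ, ∑ a ∈ Finset.range m, (((x + d + (a : ℕ)) / (m : ℤ)) - (x + a) / (m : ℤ))
      ≤ d := by
    intro d
    induction d with
    | zero => simp
    | succ d ih =>
      rcases Nat.eq_zero_or_pos m with rfl | hm
      · simp; omega
      have h := Finset.sum_range_succ_sub_sum (fun a : ℕ => (x + d + a) / (m : ℤ)) (n := m)
      have h' := Finset.sum_range_succ' (fun a : ℕ => (x + d + a) / (m : ℤ)) m
      have h3 : (x + d + (m : ℤ)) / (m : ℤ) = (x + d) / m + 1 := by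
        rw [Int.add_ediv_of_dvd_right (dvd_refl _), Int.ediv_self (by omega)]
      have h4 : ∀ a : ℕ, (x + ((d + 1 : ℕ) : ℤ) + (a : ℤ)) = x + d + ((a + 1 : ℕ) : ℤ) := by
        intro a; push_cast; ring
      simp only [Finset.sum_sub_distrib, h4] at ih ⊢
      simp only [Nat.cast_zero, add_zero] at h'
      rw [h3] at h
      push_cast at *
      linarith
  obtain ⟨d, rfl⟩ := Int.le.dest hxy
  rw [show |x - (x + (d : ℤ))| = d by simp]
  refine le_trans ?_ (hsum d)
  rw [Finset.card_filter]
  push_cast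
  -- Quotients are monotone integers, so each separating shift contributes at least one.
  refine Finset.sum_le_sum fun a ha => ?_
  have hm : 0 < m := (Nat.zero_le a).trans_lt (Finset.mem_range.1 ha)
  have hmono : (x + a) / (m : ℤ) ≤ (x + d + a) / (m : ℤ) :=
    Int.ediv_le_ediv (by omega) (by omega)
  split_ifs <;> omega

namespace Circuit

variable {lam : ℝ} {C : Circuit lam}

theorem Node.exists_coord (u : C.Node) :
    ∃ q : ℤ × ℤ, (u : Plane) 0 = q.1 * lam ∧ (u : Plane) 1 = q.2 * lam := by
  obtain ⟨s, t, h⟩ := (C.nodes_subset u.2).1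
  exact ⟨(s, t), h⟩

/-- The integer coordinates of a node. -/
noncomputable def Node.coord (u : C.Node) : ℤ × ℤ := u.exists_coord.choose

theorem Node.apply_zero (u : C.Node) : (u : Plane) 0 = u.coord.1 * lam :=
  u.exists_coord.choose_spec.1

theorem Node.apply_one (u : C.Node) : (u : Plane) 1 = u.coord.2 * lam :=
  u.exists_coord.choose_spec.2

theorem Node.coord_injective : Function.Injective (Node.coord (C := C)) := by
  intro u v h
  apply Subtype.ext
  ext i
  fin_cases i
  · simp [u.apply_zero, v.apply_zero, h]
  · simp [u.apply_one, v.apply_one, h]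

theorem Node.abs_coord_sub_le (hlam : 0 < lam) (u v : C.Node) :
    ((|u.coord.1 - v.coord.1| + |u.coord.2 - v.coord.2| : ℤ) : ℝ) ≤
      2 / lam * dist (u : Plane) (v : Plane) := by
  have h (i : Fin 2) : |(u : Plane) i - (v : Plane) i| ≤ dist (u : Plane) (v : Plane) := by
    rw [dist_eq_norm]
    simpa using PiLp.norm_apply_le ((u : Plane) - (v : Plane)) i
  have h0 := h 0
  have h1 := h 1
  rw [u.apply_zero, v.apply_zero, ← sub_mul, abs_mul, abs_of_pos hlam] at h0
  rw [u.apply_one, v.apply_one, ← sub_mul, abs_mul, abs_of_pos hlam] at h1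
  push_cast
  rw [div_mul_eq_mul_div, le_div_iff₀ hlam]
  linarith

/-- The cell of a node when the grid is divided into cells of `m × m` points, shifted by `a`. -/
noncomputable def Node.cell (m a : ℕ) (u : C.Node) : ℤ × ℤ :=
  ((u.coord.1 + a) / (m : ℤ), (u.coord.2 + a) / (m : ℤ))

theorem Node.card_shift_cell_ne_le (m : ℕ) (u v : C.Node) :
    (((Finset.range m).filter fun a => u.cell m a ≠ v.cell m a).card : ℤ) ≤
      |u.coord.1 - v.coord.1| + |u.coord.2 - v.coord.2| := by
  refine le_trans ?_ (add_le_add (card_shift_ediv_ne_le m _ _) (card_shift_ediv_ne_le m _ _))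
  rw [← Nat.cast_add, Nat.cast_le]
  refine le_trans (Finset.card_le_card ?_) (Finset.card_union_le _ _)
  intro a
  simp only [Finset.mem_filter, Finset.mem_union, Node.cell, ne_eq, Prod.mk.injEq]
  tauto

end Circuit

/-! ### Bit-meters and the traffic between cells -/

namespace FixedLengthComputation

open Circuit

variable {lam : ℝ} {C : Circuit lam} {m m' : ℕ}

theorem numInputs_le_card (A : FixedLengthComputation C m m') {T : Set C.Node}
    {B : Finset (ℤ × ℤ)} (h : ∀ u ∈ T, u.coord ∈ B) : A.numInputs T ≤ B.card := by
  classical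
  rw [numInputs, ← Finset.card_univ]
  exact Finset.card_le_card_of_injOn (fun i => (A.inputNode i.1).coord) (fun i _ => h _ i.2)
    fun i _ j _ hij => Subtype.ext (A.inputNode.injective (Node.coord_injective hij))

theorem numInputs_cell_le (A : FixedLengthComputation C m m') {s : ℕ} (hs : 0 < s) (a : ℕ)
    (q : ℤ × ℤ) : A.numInputs {u | u.cell s a = q} ≤ s ^ 2 := by
  let B : Finset (ℤ × ℤ) := Finset.Ico (q.1 * s - a) (q.1 * s - a + s) ×ˢ
    Finset.Ico (q.2 * s - a) (q.2 * s - a + s)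
  have hB : B.card = s ^ 2 := by
    simp [B, sq]
  rw [← hB]
  refine A.numInputs_le_card fun u hu => ?_
  have hs' : (0 : ℤ) < s := by exact_mod_cast hs
  obtain ⟨h1, h2⟩ := Prod.ext_iff.1 (show u.cell s a = q from hu)
  simp only [Node.cell] at h1 h2
  rw [Int.ediv_eq_iff_of_pos hs'] at h1 h2
  simp only [B, Finset.mem_product, Finset.mem_Ico]
  constructor <;> constructor <;> linarith

theorem bitMeters_eq_sum (A : FixedLengthComputation C m m') :
    A.bitMeters = ∑ t, (A.bits t : ℝ) * dist (A.src t : Plane) (A.dst t : Plane) := by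
  classical
  unfold bitMeters linkBitMeters linkBits
  simp only [Nat.cast_sum, Finset.sum_mul]
  rw [Finset.sum_congr rfl fun u _ => Finset.sum_comm, Finset.sum_comm]
  refine Finset.sum_congr rfl fun t _ => ?_
  rw [Finset.sum_eq_single (A.src t), Finset.sum_eq_single (A.dst t)]
  · simp
  · intro v _ hv
    simp [hv.symm]
  · simp
  · intro u _ hu
    exact Finset.sum_eq_zero fun v _ => by simp [hu.symm]
  · simp

theorem bitMeters_nonneg (A : FixedLengthComputation C m m') : 0 ≤ A.bitMeters := by
  rw [bitMeters_eq_sum]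
  positivity

open Classical in
/-- Few bits cross between cells, for a suitable shift. -/
theorem exists_shift (hlam : 0 < lam) (A : FixedLengthComputation C m m') {s : ℕ} (hs : 0 < s) :
    ∃ a, s * ((∑ t, if (A.src t).cell s a ≠ (A.dst t).cell s a then A.bits t else 0 : ℕ) : ℝ) ≤
      2 / lam * A.bitMeters := by
  by_contra! hcon
  set f : ℕ → ℕ := fun a =>
    ∑ t, if (A.src t).cell s a ≠ (A.dst t).cell s a then A.bits t else 0 with hf
  -- The number of shifts that cut a message is at most its `ℓ¹` length in lattice units, so this
  -- total is bounded independently of `s`.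
  have h1 : ∑ a ∈ Finset.range s, (f a : ℝ) ≤ 2 / lam * A.bitMeters := by
    rw [bitMeters_eq_sum, Finset.mul_sum]
    simp only [hf, Nat.cast_sum]
    rw [Finset.sum_comm]
    refine Finset.sum_le_sum fun t _ => ?_
    have h := Node.card_shift_cell_ne_le s (A.src t) (A.dst t)
    have h' : (((Finset.range s).filter fun a =>
        (A.src t).cell s a ≠ (A.dst t).cell s a).card : ℝ) ≤
        2 / lam * dist (A.src t : Plane) (A.dst t : Plane) :=
      le_trans (by exact_mod_cast h) (Node.abs_coord_sub_le hlam (A.src t) (A.dst t))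
    calc _ = (((Finset.range s).filter fun a =>
        (A.src t).cell s a ≠ (A.dst t).cell s a).card : ℝ) * A.bits t := by
          rw [← nsmul_eq_mul, ← Finset.sum_const, Finset.sum_filter]
          exact Finset.sum_congr rfl fun a _ => by split_ifs <;> simp
      _ ≤ _ := (mul_le_mul_of_nonneg_right h' (Nat.cast_nonneg _)).trans_eq (by ring)
  have h2 : ∑ a ∈ Finset.range s, (2 / lam * A.bitMeters) <
      ∑ a ∈ Finset.range s, s * (f a : ℝ) :=
    Finset.sum_lt_sum_of_nonempty (Finset.nonempty_range_iff.2 hs.ne') fun a _ => hcon a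
  rw [Finset.sum_const, Finset.card_range, nsmul_eq_mul, ← Finset.mul_sum] at h2
  have := lt_of_mul_lt_mul_left h2 (Nat.cast_nonneg s)
  linarith

open Classical in
/-- If few bits are sent over long distances, fewer bits enter some cell than are output there. -/
theorem exists_cell_inflow_lt (hlam : 0 < lam) (A : FixedLengthComputation C m m') {s : ℕ}
    (hs : 0 < s) (h : 2 / lam * A.bitMeters < s * m') :
    ∃ a q, A.inflow {u | u.cell s a = q} < A.numOutputs {u | u.cell s a = q} := by
  obtain ⟨a, ha⟩ := A.exists_shift hlam hs
  have hlt : (∑ t, if (A.src t).cell s a ≠ (A.dst t).cell s a then A.bits t else 0) < m' := by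
    have := lt_of_mul_lt_mul_left (ha.trans_lt h) (Nat.cast_nonneg s)
    exact_mod_cast this
  refine ⟨a, ?_⟩
  by_contra! hcon
  refine absurd hlt (not_lt.2 ?_)
  set Q := Finset.univ.image fun j => (A.outputNode j).cell s a
  calc m' = ∑ q ∈ Q, A.numOutputs {u | u.cell s a = q} := by
        have := Finset.card_eq_sum_card_image (fun j => (A.outputNode j).cell s a)
          (Finset.univ : Finset (Fin m'))
        rw [Finset.card_univ, Fintype.card_fin] at this
        refine this.trans (Finset.sum_congr rfl fun q _ => ?_)
        rw [numOutputs, Fintype.card_subtype]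
        rfl
    _ ≤ ∑ q ∈ Q, A.inflow {u | u.cell s a = q} := Finset.sum_le_sum fun q _ => hcon q
    -- A crossing message enters only the cell of its destination, so it is counted at most once.
    _ ≤ _ := by
        unfold inflow
        rw [Finset.sum_comm]
        refine Finset.sum_le_sum fun t _ => ?_
        by_cases ht : (A.src t).cell s a = (A.dst t).cell s a
        · simp [ht]
        · calc _ ≤ ∑ q ∈ Q, if (A.dst t).cell s a = q then A.bits t else 0 := by
                refine Finset.sum_le_sum fun q _ => ?_
                by_cases hq : (A.dst t).cell s a = q
                · rw [if_pos hq]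
                  split_ifs <;> simp
                · simp [hq]
            _ ≤ _ := by
                rw [Finset.sum_ite_eq, if_pos ht]
                split_ifs <;> simp

end FixedLengthComputation

/-! ### Error probability and energy -/

namespace CommSystem

variable {lam R : ℝ}

theorem exp_le_blockErrorProb (hlam : 0 < lam) {zeta sigmaSq : ℝ} (hzeta : 0 < zeta)
    (hsigmaSq : 0 < sigmaSq) (S : CommSystem lam R) {s : ℕ} (hs : 0 < s)
    (h : 2 / lam * S.decoder.bitMeters < s * S.k) :
    Real.exp (-((zeta * S.power / sigmaSq + 3) * s ^ 2 + 1)) ≤ S.blockErrorProb zeta sigmaSq := by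
  set x := Real.sqrt (zeta * S.power / sigmaSq) with hx
  have hxsq : x ^ 2 = zeta * S.power / sigmaSq :=
    Real.sq_sqrt (div_nonneg (mul_nonneg hzeta.le S.power_nonneg) hsigmaSq.le)
  have hxnn : 0 ≤ x := Real.sqrt_nonneg _
  have hp := exp_le_gaussianQ hxnn
  have hp1 := gaussianQ_le_half hxnn
  have hp0 : 0 < gaussianQ x := (Real.exp_pos _).trans_le hp
  obtain ⟨a, q, haq⟩ := S.decoder.exists_cell_inflow_lt hlam hs h
  have herr := S.decoder.le_error_of_inflow_lt _ haq hp0 hp1 S.encoder.output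
  refine le_trans ?_ herr
  -- Each factor `1 / 2` in the error bound costs one unit in the exponent: `2` becomes `3`, and the
  -- final `1` is added.
  have he : Real.exp (-1) ≤ 1 / 2 := by
    rw [Real.exp_neg, ← one_div]
    exact one_div_le_one_div_of_le two_pos (by linarith [Real.exp_one_gt_d9])
  have h1 : Real.exp (-(x ^ 2 + 3)) ≤ gaussianQ x / 2 := by
    calc Real.exp (-(x ^ 2 + 3)) = Real.exp (-(x ^ 2 + 2)) * Real.exp (-1) := by
          rw [← Real.exp_add]; congr 1; ring
      _ ≤ gaussianQ x * (1 / 2) := mul_le_mul hp he (Real.exp_pos _).le hp0.le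
      _ = _ := by ring
  calc Real.exp (-((zeta * S.power / sigmaSq + 3) * s ^ 2 + 1))
      = Real.exp (-(x ^ 2 + 3)) ^ (s ^ 2) * Real.exp (-1) := by
        rw [← Real.exp_nat_mul, ← Real.exp_add, hxsq]
        congr 1
        push_cast
        ring
    _ ≤ (gaussianQ x / 2) ^ (s ^ 2) * (1 / 2) :=
        mul_le_mul (pow_le_pow_left₀ (Real.exp_pos _).le h1 _) he (Real.exp_pos _).le
          (by positivity)
    _ ≤ (gaussianQ x / 2) ^ (S.decoder.numInputs {u | u.cell s a = q}) * (1 / 2) := by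
        refine mul_le_mul_of_nonneg_right ?_ (by norm_num)
        exact pow_le_pow_of_le_one (by positivity) (by linarith)
          (S.decoder.numInputs_cell_le hs a q)
    _ = _ := by ring

variable {mu zeta sigmaSq W : ℝ}

/-- The logarithm of the error probability is at most cubic in the energy per bit. -/
theorem log_blockErrorProb_le (hlam : 0 < lam) (hmu : 0 < mu) (hzeta : 0 < zeta)
    (hsigmaSq : 0 < sigmaSq) (hW : 0 < W) (hR : 0 < R) :
    ∃ K : ℝ, 0 < K ∧ ∀ S : CommSystem lam R, 0 < S.blockErrorProb zeta sigmaSq ∧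
      0 ≤ S.energyPerBit mu W ∧
      Real.log (1 / S.blockErrorProb zeta sigmaSq) ≤ K * (1 + S.energyPerBit mu W) ^ 3 := by
  set α := zeta * (W * R) / sigmaSq with hα
  set β := 2 / (lam * mu) with hβ
  have hα0 : 0 < α := by positivity
  have hβ0 : 0 < β := by positivity
  refine ⟨(α + 3) * (β + 1) ^ 2 + 1, by positivity, fun S => ?_⟩
  have hk : (0 : ℝ) < S.k := by exact_mod_cast S.k_pos
  have hn : (0 : ℝ) < S.n := by exact_mod_cast S.n_pos
  have hP := S.power_nonneg
  have hB := S.decoder.bitMeters_nonneg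
  have hB' := S.encoder.bitMeters_nonneg
  set E := S.energyPerBit mu W with hE
  have hEk : E * S.k = S.n * S.power / W + mu * S.encoder.bitMeters + mu * S.decoder.bitMeters := by
    rw [hE, energyPerBit, div_mul_cancel₀ _ hk.ne', totalEnergy, transmitEnergy,
      FixedLengthComputation.frictionEnergy, FixedLengthComputation.frictionEnergy]
  have hT0 : 0 ≤ S.n * S.power / W := by positivity
  have hE1 : mu * S.encoder.bitMeters ≥ 0 := by positivity
  have hD1 : mu * S.decoder.bitMeters ≥ 0 := by positivity
  have hE0 : 0 ≤ E := nonneg_of_mul_nonneg_left (b := (S.k : ℝ)) (by rw [hEk]; linarith) hk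
  have hkn : (S.k : ℝ) = R * S.n := by
    exact (div_eq_iff hn.ne').1 S.rate_eq
  have hpow : S.power ≤ W * R * E := by
    have h1 : S.n * S.power / W ≤ E * S.k := by linarith
    rw [div_le_iff₀ hW, hkn] at h1
    refine le_of_mul_le_mul_left (a := (S.n : ℝ)) ?_ hn
    linarith
  have hbm : 2 / lam * S.decoder.bitMeters ≤ β * E * S.k := by
    have h1 : mu * S.decoder.bitMeters ≤ E * S.k := by linarith
    calc 2 / lam * S.decoder.bitMeters = β * (mu * S.decoder.bitMeters) := by
          rw [hβ]; field_simp
      _ ≤ β * (E * S.k) := mul_le_mul_of_nonneg_left h1 hβ0.le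
      _ = _ := by ring
  -- The least natural number above `β * E`: large enough for the strict inequality on bit-meters,
  -- and positive even if `E = 0`.
  set s := ⌊β * E⌋₊ + 1 with hs
  have hs1 : β * E < s := by
    rw [hs]; push_cast; exact Nat.lt_floor_add_one _
  have hs2 : (s : ℝ) ≤ (β + 1) * (1 + E) := by
    have := Nat.floor_le (a := β * E) (by positivity)
    rw [hs]; push_cast
    nlinarith
  have hmain := S.exp_le_blockErrorProb hlam hzeta hsigmaSq (s := s) (Nat.succ_pos _)
    (hbm.trans_lt (mul_lt_mul_of_pos_right hs1 hk))
  -- This excludes error probability zero, where `Real.log (1 / 0) = 0` would make the logarithmic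
  -- bound empty.
  have hpos : 0 < S.blockErrorProb zeta sigmaSq := (Real.exp_pos _).trans_le hmain
  refine ⟨hpos, hE0, ?_⟩
  have hlog : Real.log (1 / S.blockErrorProb zeta sigmaSq) ≤
      (zeta * S.power / sigmaSq + 3) * s ^ 2 + 1 := by
    have h1 := (Real.le_log_iff_exp_le hpos).2 hmain
    rw [one_div, Real.log_inv]
    linarith
  have hsnr : zeta * S.power / sigmaSq + 3 ≤ (α + 3) * (1 + E) := by
    have h1 : zeta * S.power / sigmaSq ≤ α * E := by
      rw [hα, div_mul_eq_mul_div]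
      refine div_le_div_of_nonneg_right ?_ hsigmaSq.le
      calc zeta * S.power ≤ zeta * (W * R * E) := mul_le_mul_of_nonneg_left hpow hzeta.le
        _ = _ := by ring
    nlinarith
  calc _ ≤ (zeta * S.power / sigmaSq + 3) * s ^ 2 + 1 := hlog
    _ ≤ (α + 3) * (1 + E) * ((β + 1) * (1 + E)) ^ 2 + (1 + E) ^ 3 := by
        refine add_le_add (mul_le_mul hsnr ?_ (by positivity) (by positivity)) ?_
        · exact pow_le_pow_left₀ (Nat.cast_nonneg _) hs2 2
        · exact one_le_pow₀ (by linarith)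
    _ = _ := by ring

end CommSystem

theorem mainTheorem3 (lam mu zeta sigmaSq W R : ℝ) (hlam : 0 < lam) (hmu : 0 < mu)
    (hzeta : 0 < zeta) (hsigmaSq : 0 < sigmaSq) (hW : 0 < W) (hR : 0 < R) :
    (∃ c : ℝ, 0 < c ∧ ∃ ε : ℝ, 0 < ε ∧ ∀ S : CommSystem lam R,
      S.blockErrorProb zeta sigmaSq ≤ ε →
        c * (Real.log (1 / S.blockErrorProb zeta sigmaSq)) ^ (1 / 3 : ℝ) ≤ S.energyPerBit mu W) ∧
    (∀ M : ℝ, ∃ ε : ℝ, 0 < ε ∧ ∀ S : CommSystem lam R,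
      S.blockErrorProb zeta sigmaSq ≤ ε → M ≤ S.energyPerBit mu W) := by
  obtain ⟨K, hK, h⟩ := CommSystem.log_blockErrorProb_le hlam hmu hzeta hsigmaSq hW hR
  set κ := K ^ (1 / 3 : ℝ) with hκ
  have hκ0 : 0 < κ := Real.rpow_pos_of_pos hK _
  have hcbrt : ∀ a : ℝ, 0 ≤ a → (a ^ 3) ^ (1 / 3 : ℝ) = a := fun a ha => by
    rw [← Real.rpow_natCast a 3, ← Real.rpow_mul ha]
    norm_num
  have hlog : ∀ (L : ℝ) (S : CommSystem lam R), S.blockErrorProb zeta sigmaSq ≤ Real.exp (-L) →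
      L ≤ Real.log (1 / S.blockErrorProb zeta sigmaSq) := fun L S hS => by
    rw [one_div, Real.log_inv]
    linarith [(Real.log_le_iff_le_exp (h S).1).2 hS]
  -- This threshold forces `1 + E ≥ 2`, so `1 + E ≤ 2 * E`; hence the constant `1 / (2 * κ)`.
  have hbound : ∀ S : CommSystem lam R, S.blockErrorProb zeta sigmaSq ≤ Real.exp (-(K * 2 ^ 3)) →
      1 / (2 * κ) * Real.log (1 / S.blockErrorProb zeta sigmaSq) ^ (1 / 3 : ℝ) ≤
        S.energyPerBit mu W := by
    intro S hS
    obtain ⟨-, hE, hle⟩ := h S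
    have hL := hlog _ S hS
    have h2 : 2 ≤ 1 + S.energyPerBit mu W :=
      le_of_pow_le_pow_left₀ three_ne_zero (by linarith)
        (le_of_mul_le_mul_left (hL.trans hle) hK)
    have h3 : Real.log (1 / S.blockErrorProb zeta sigmaSq) ^ (1 / 3 : ℝ) ≤
        κ * (1 + S.energyPerBit mu W) := by
      refine (Real.rpow_le_rpow (le_trans (by positivity) hL) hle (by norm_num)).trans_eq ?_
      rw [Real.mul_rpow hK.le (by positivity), hcbrt _ (by linarith)]
    rw [one_div_mul_eq_div, div_le_iff₀ (by positivity)]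
    nlinarith
  refine ⟨⟨1 / (2 * κ), by positivity, _, Real.exp_pos _, hbound⟩, fun M => ?_⟩
  -- The second term makes the cube root of the logarithm at least `2 * κ * max M 0`; the maximum
  -- covers negative `M`.
  refine ⟨min (Real.exp (-(K * 2 ^ 3))) (Real.exp (-((2 * κ * max M 0) ^ 3))),
    lt_min (Real.exp_pos _) (Real.exp_pos _), fun S hS => ?_⟩
  refine le_trans ?_ (hbound S (hS.trans (min_le_left _ _)))
  have hM : 0 ≤ 2 * κ * max M 0 := mul_nonneg (by positivity) (le_max_right _ _)
  have h1 := Real.rpow_le_rpow (z := 1 / 3) (by positivity)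
    (hlog _ S (hS.trans (min_le_right _ _))) (by norm_num)
  rw [hcbrt _ hM] at h1
  rw [one_div_mul_eq_div, le_div_iff₀ (by positivity)]
  nlinarith [le_max_left M 0]
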